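/- **Setting.** Let $d,m\in\mathbb{N}_0$, $A\in GL(d,\mathbb{R})$, $B\in\mathbb{R}^{d\times m}$, and let $U\subset\mathbb{R}^m$ be a compact convex neighborhood of $0$ with $U=\overline{\operatorname{int}U}$. Consider the control system $$x_{k+1}=Ax_k+Bu_k,\qquad u_k\in U,\ k=0,1,2,\dots$$ Write $\mathcal{U}=U^{\mathbb{N}_0}$ for the set of controls and $\varphi(k,x,u)$ for the solution at time $k$ with initial value $x\in\mathbb{R}^d$ and control $u\in\mathcal{U}$. Let $\mathbf{R}(x)=\{\varphi(k,x,u): k\ge 1,\ u\in\mathcal{U}\}$. A control set is a nonvoid set $D\subset\mathbb{R}^d$ that is maximal (for inclusion) with the properties (i) $D\subset\overline{\mathbf{R}(x)}$ for all $x\in D$; (ii) for every $x\in D$ there is $u\in\mathcal{U}$ with $\varphi(k,x,u)\in D$ for all $k\ge1$. The pair $(A,B)$ is controllable if $\operatorname{rank}[B\ AB\ \cdots\ A^{d-1}B]=d$, and $A$ is hyperbolic if no (complex) eigenvalue of $A$ has absolute value $1$. The unstable determinant $\det A^+$ is the product, with algebraic multiplicities $n_\lambda$, of the eigenvalues $\lambda$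 of $A$ with $|\lambda|>1$, so $\log|\det A^+|=\sum_{\lambda}n_\lambda\max\{0,\log|\lambda|\}$. A pair $(K,Q)$ of nonvoid subsets of $\mathbb{R}^d$ is admissible if $K\subset Q$ is compact and for every $x\in K$ there is $u\in\mathcal{U}$ with $\varphi(k,x,u)\in Q$ for all $k\ge1$. For $\tau\in\mathbb{N}$, a set $\mathcal{S}\subset\mathcal{U}$ is $(\tau,K,Q)$-spanning if for every $x\in K$ there is $u\in\mathcal{S}$ with $\varphi(k,x,u)\in Q$ for $k=1,\dots,\tau$. A totally $(\tau,K,Q)$-spanning set is a set $\mathcal{S}_{tot}=\{(x_u,u):u\in\mathcal{S}\}$, where $\mathcal{S}$ is $(\tau,K,Q)$-spanning and, for each $u\in\mathcal{S}$, $x_u$ is one chosen point of $K$ with $\varphi(k,x_u,u)\in Q$ for $k=1,\dots,\tau$. For a continuous function $f$ put $(S_\tau f)(x,u)=\sum_{i=0}^{\tau-1}f(\varphi(i,x,u),u_i)$, $$a_\tau(f,K,Q)=\inf\Big\{\sum_{(x,u)\in\mathcal{S}_{tot}}e^{(S_\tau f)(x,u)} : \mathcal{S}_{tot}\text{ totally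 }(\tau,K,Q)\text{-spanning}\Big\}\in[0,\infty],$$ $$P_{tot}(f,K,Q)=\limsup_{\tau\to\infty}\frac1\tau\log a_\tau(f,K,Q)\in[-\infty,\infty].$$ **Proposition.** Assume that $(A,B)$ is controllable and $A$ is hyperbolic. Let $D$ be the (unique) control set with nonvoid interior, and let $f:\overline{D}\times U\to\mathbb{R}$ be continuous. Then there exists a compact set $K\subset D$ with nonvoid interior such that $(K,D)$ is admissible and $$P_{tot}(f,K,D)\le\log|\det A^+|+\inf_{(\tau,x,u)}\frac1\tau\sum_{i=0}^{\tau-1}f(\varphi(i,x,u),u_i),$$ where the infimum is taken over all integers $\tau\ge1$ with $\tau\ge d$ and all $\tau$-periodic controls $u\in\mathcal{U}$ with a $\tau$-periodic trajectory $\varphi(\cdot,x,u)$ in $\operatorname{int}D$ such that $u_i\in\operatorname{int}U$ for $i\in\{0,\dots,\tau-1\}$. -/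

import Mathlib

open Set Filter Topology

noncomputable section

namespace DTControl

/-! Discrete-time control systems `x_{k+1} = F (x_k, u_k)`, `k = 0, 1, 2, …`, on a state space `X`
with control values in a set `U`. -/

section General

variable {X V : Type*}

/-- The solution `φ(k, x, u)` with initial value `x` and control `u`. -/
def traj (F : X → V → X) (x : X) (u : ℕ → V) : ℕ → X
  | 0 => x
  | k + 1 => F (traj F x u k) (u k)

/-- The set of controls: all sequences with values in `U`. -/
def controls (U : Set V) : Set (ℕ → V) := {u | ∀ k, u k ∈ U}

/-- The set `R(x)` of points that can be reached from `x` at some positive time. -/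
def reachable (F : X → V → X) (U : Set V) (x : X) : Set X :=
  {y | ∃ k : ℕ, 1 ≤ k ∧ ∃ u ∈ controls U, y = traj F x u k}

/-- A control set: a nonvoid set `D` that is maximal (for inclusion) with the two properties
(i) `D ⊆ closure R(x)` for all `x ∈ D`, and
(ii) for all `x ∈ D` there is a control keeping the solution from `x` in `D` at all times. -/
def IsControlSet [TopologicalSpace X] (F : X → V → X) (U : Set V) (D : Set X) : Prop :=
  Maximal (fun E : Set X => E.Nonempty ∧ (∀ x ∈ E, E ⊆ closure (reachable F U x)) ∧
    ∀ x ∈ E, ∃ u ∈ controls U, ∀ k : ℕ, 1 ≤ k → traj F x u k ∈ E) D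

/-- Admissible pairs `(K, Q)`. -/
def IsAdmissiblePair [TopologicalSpace X] (F : X → V → X) (U : Set V) (K Q : Set X) : Prop :=
  K.Nonempty ∧ K ⊆ Q ∧ IsCompact K ∧
    ∀ x ∈ K, ∃ u ∈ controls U, ∀ k : ℕ, 1 ≤ k → traj F x u k ∈ Q

/-- A `(τ, K, Q)`-spanning set of controls. -/
def IsSpanning (F : X → V → X) (U : Set V) (τ : ℕ) (K Q : Set X) (S : Set (ℕ → V)) : Prop :=
  S ⊆ controls U ∧ ∀ x ∈ K, ∃ u ∈ S, ∀ k ∈ Finset.Icc 1 τ, traj F x u k ∈ Q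

/-- A totally `(τ, K, Q)`-spanning set: the set of pairs `(x_u, u)`, `u ∈ S`, for a spanning set `S`
and a choice, for each `u ∈ S`, of one initial value `x_u ∈ K` whose solution under `u` is in `Q`
at the times `1, …, τ`. -/
def IsTotallySpanning (F : X → V → X) (U : Set V) (τ : ℕ) (K Q : Set X)
    (T : Set (X × (ℕ → V))) : Prop :=
  ∃ S : Set (ℕ → V), IsSpanning F U τ K Q S ∧ ∃ ξ : (ℕ → V) → X,
    (∀ u ∈ S, ξ u ∈ K ∧ ∀ k ∈ Finset.Icc 1 τ, traj F (ξ u) u k ∈ Q) ∧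
    T = (fun u => (ξ u, u)) '' S

/-- `(S_τ f)(x, u) = ∑_{i < τ} f (φ(i, x, u), u_i)`. -/
def potentialSum (F : X → V → X) (f : X × V → ℝ) (τ : ℕ) (x : X) (u : ℕ → V) : ℝ :=
  ∑ i ∈ Finset.range τ, f (traj F x u i, u i)

/-- `a_τ(f, K, Q) ∈ [0, ∞]`. -/
def aTot (F : X → V → X) (U : Set V) (f : X × V → ℝ) (K Q : Set X) (τ : ℕ) : ENNReal :=
  ⨅ T : {T : Set (X × (ℕ → V)) // IsTotallySpanning F U τ K Q T},
    ∑' p : T.1, ENNReal.ofReal (Real.exp (potentialSum F f τ p.1.1 p.1.2))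

/-- The total invariance pressure `limsup_{τ → ∞} (1/τ) log a_τ(f, K, Q) ∈ [-∞, ∞]`. -/
def totalPressure (F : X → V → X) (U : Set V) (f : X × V → ℝ) (K Q : Set X) : EReal :=
  limsup (fun τ : ℕ => (((τ : ℝ)⁻¹ : ℝ) : EReal) * ENNReal.log (aTot F U f K Q τ)) atTop

/-- `u` is a `τ`-periodic control (`τ ≥ 1`, not necessarily the least period) with a `τ`-periodic
trajectory `φ(·, x, u)` in the interior of `D`, and with all its values in the interior of `U`. -/
def IsPeriodicPair [TopologicalSpace X] [TopologicalSpace V] (F : X → V → X) (U : Set V) (D : Set X)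
    (τ : ℕ) (x : X) (u : ℕ → V) : Prop :=
  1 ≤ τ ∧ u ∈ controls U ∧ Function.Periodic u τ ∧ Function.Periodic (traj F x u) τ ∧
    (∀ k, traj F x u k ∈ interior D) ∧ ∀ i < τ, u i ∈ interior U

/-- The infimum, in `[-∞, ∞]`, of the averages `(1/τ) ∑_{i < τ} f (φ(i, x, u), u_i)` over all
`τ ≥ n` and all periodic pairs as in `IsPeriodicPair`. -/
def infPeriodicAverage [TopologicalSpace X] [TopologicalSpace V] (F : X → V → X) (U : Set V)
    (D : Set X) (f : X × V → ℝ) (n : ℕ) : EReal :=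
  sInf {a : EReal | ∃ (τ : ℕ) (x : X) (u : ℕ → V), n ≤ τ ∧ IsPeriodicPair F U D τ x u ∧
    a = (((τ : ℝ)⁻¹ * potentialSum F f τ x u : ℝ) : EReal)}

end General

section Linear

variable {d m : ℕ}

/-- The right-hand side of the linear control system `x_{k+1} = A x_k + B u_k`. -/
def linSys (A : Matrix (Fin d) (Fin d) ℝ) (B : Matrix (Fin d) (Fin m) ℝ)
    (x : Fin d → ℝ) (u : Fin m → ℝ) : Fin d → ℝ :=
  A.mulVec x + B.mulVec u

/-- The matrix `[B, A B, …, A^{d-1} B]`. -/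
def kalmanMatrix (A : Matrix (Fin d) (Fin d) ℝ) (B : Matrix (Fin d) (Fin m) ℝ) :
    Matrix (Fin d) (Fin d × Fin m) ℝ :=
  Matrix.of fun i p => (A ^ (p.1 : ℕ) * B) i p.2

/-- The pair `(A, B)` is controllable. -/
def IsControllablePair (A : Matrix (Fin d) (Fin d) ℝ) (B : Matrix (Fin d) (Fin m) ℝ) : Prop :=
  (kalmanMatrix A B).rank = d

/-- `A` is hyperbolic: no complex eigenvalue has absolute value `1`. -/
def IsHyperbolic (A : Matrix (Fin d) (Fin d) ℝ) : Prop :=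
  ∀ z ∈ spectrum ℂ (A.map (algebraMap ℝ ℂ)), ‖z‖ ≠ 1

/-- The complex eigenvalues of `A`, with their algebraic multiplicities. -/
def eigenvaluesC (A : Matrix (Fin d) (Fin d) ℝ) : Multiset ℂ :=
  (A.map (algebraMap ℝ ℂ)).charpoly.roots

open Classical in
/-- The unstable determinant `det A⁺`: the product, with algebraic multiplicities, of the
eigenvalues `z` of `A` with `|z| > 1`. -/
def unstableDet (A : Matrix (Fin d) (Fin d) ℝ) : ℂ :=
  ((eigenvaluesC A).filter fun z => 1 < ‖z‖).prod

/-- `log |det A⁺| = ∑ n_z max {0, log |z|}` over the eigenvalues `z` of multiplicity `n_z`. -/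
theorem log_norm_unstableDet (A : Matrix (Fin d) (Fin d) ℝ) :
    Real.log ‖unstableDet A‖ =
      ((eigenvaluesC A).map fun z => max 0 (Real.log ‖z‖)).sum := by
  classical
  unfold unstableDet
  induction eigenvaluesC A using Multiset.induction_on with
  | empty => simp
  | cons z s ih =>
    by_cases hz : 1 < ‖z‖
    · have h0 : ‖(s.filter fun z => 1 < ‖z‖).prod‖ ≠ 0 := by
        rw [norm_ne_zero_iff]
        intro h
        rw [Multiset.prod_eq_zero_iff] at h
        have := (Multiset.mem_filter.1 h).2
        simp at this
        linarith
      rw [Multiset.filter_cons_of_pos (p := fun z : ℂ => 1 < ‖z‖) s hz, Multiset.prod_cons, norm_mul,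
        Real.log_mul (by linarith) h0, Multiset.map_cons, Multiset.sum_cons, ← ih,
        max_eq_right (Real.log_nonneg hz.le)]
    · rw [Multiset.filter_cons_of_neg (p := fun z : ℂ => 1 < ‖z‖) s hz, Multiset.map_cons, Multiset.sum_cons, ← ih,
        max_eq_left (Real.log_nonpos (norm_nonneg _) (not_lt.1 hz)), zero_add]

end Linear

end DTControl

end

open DTControl

/-!
The bound is proved for every nonempty compact `K ⊆ D`, and for each periodic pair
`(τ, x₀, u₀)` and each `ε > 0` separately.

*Local part.* The system is linear, so near the periodic trajectory it suffices to control
`y ↦ A y + B v` near the origin, with small `v`. Hyperbolicity splits the state space into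
subspaces on which `A` acts by an expanding matrix `M` and a contracting matrix `N`, with
`|det M| = |det A⁺|` (`exists_hyperbolic_splitting`). The unit ball of the unstable subspace is
covered by the preimages under `M ^ n` of unit balls around the images of at most
`const * |det M| ^ n` centers: for a maximal separated set of centers the preimages of the balls of half the
radius are disjoint, and volumes are compared (`exists_centers`). By controllability each center `c` is steered to the origin
in `d` steps at a cost proportional to `‖c‖` (`IsControllablePair.exists_null_control`). The same
control moves `y` to `A ^ n (y - c)`, which is again in the neighborhood: in the unstable direction
by the choice of `c`, in the stable direction since `N ^ n` tends to `0`. Hence about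
`|det A⁺| ^ n` controls keep a neighborhood for one block of length `n` (`exists_blocks_zero`). Scaled
down and added to `u₀`, with `n` a multiple of `τ`, they keep a neighborhood of `x₀` in `D`, along
trajectories on which `f` differs little from its values on the periodic one
(`exists_blocks_periodic`).

*Global part.* Finitely many controls bring `K` into that neighborhood, and the trajectories do not
leave `D` meanwhile, by maximality of the control set (`exists_steering`, `IsControlSet.traj_mem`).
Words in the block controls, preceded by one of these transients, form spanning sets, whose
exponential growth rate is `(log #blocks) / n` plus the mean of `f` along the periodic trajectory, up
to `ε` (`totalPressure_le_of_blocks`).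
-/

open Set Filter Topology
open DTControl

namespace DTControl

/-! ### Concatenation of controls -/

section General

variable {X V : Type*} {F : X → V → X} {U : Set V}

/-- The control that agrees with `v` before time `n` and from then on runs through `w`. -/
def concat (n : ℕ) (v w : ℕ → V) : ℕ → V := fun k => if k < n then v k else w (k - n)

theorem concat_mem_controls {n : ℕ} {v w : ℕ → V} (hv : v ∈ controls U) (hw : w ∈ controls U) :
    concat n v w ∈ controls U := by
  intro k
  unfold concat
  split_ifs
  · exact hv k
  · exact hw _

theorem concat_of_lt {n k : ℕ} (v w : ℕ → V) (hk : k < n) : concat n v w k = v k := by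
  simp [concat, hk]

theorem concat_add (n k : ℕ) (v w : ℕ → V) : concat n v w (n + k) = w k := by
  simp [concat]

theorem traj_add (x : X) (u : ℕ → V) (n k : ℕ) :
    traj F x u (n + k) = traj F (traj F x u n) (fun i => u (n + i)) k := by
  induction k with
  | zero => rfl
  | succ k ih => rw [← add_assoc, traj, traj, ih]

theorem traj_concat_of_le (x : X) (v w : ℕ → V) {n k : ℕ} (hk : k ≤ n) :
    traj F x (concat n v w) k = traj F x v k := by
  induction k with
  | zero => rfl
  | succ k ih => rw [traj, traj, ih (by omega), concat_of_lt v w (by omega)]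

theorem traj_concat_add (x : X) (v w : ℕ → V) (n k : ℕ) :
    traj F x (concat n v w) (n + k) = traj F (traj F x v n) w k := by
  rw [traj_add, traj_concat_of_le x v w le_rfl]
  simp only [concat_add]

/-! ### The no-return property of control sets -/

theorem reachable_subset_of_mem {x y : X} (hy : y ∈ reachable F U x) :
    reachable F U y ⊆ reachable F U x := by
  obtain ⟨n, hn, v, hv, rfl⟩ := hy
  rintro z ⟨k, hk, w, hw, rfl⟩
  exact ⟨n + k, by omega, concat n v w, concat_mem_controls hv hw, (traj_concat_add ..).symm⟩

theorem continuous_traj [TopologicalSpace X] (hF : ∀ v, Continuous fun x => F x v)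
    (u : ℕ → V) (k : ℕ) : Continuous fun x => traj F x u k := by
  induction k with
  | zero => exact continuous_id
  | succ k ih => exact (hF (u k)).comp ih

theorem traj_mem_closure_reachable [TopologicalSpace X] (hF : ∀ v, Continuous fun x => F x v)
    {x y : X} (hy : y ∈ closure (reachable F U x)) {u : ℕ → V} (hu : u ∈ controls U) (k : ℕ) :
    traj F y u k ∈ closure (reachable F U x) := by
  refine map_mem_closure (f := fun z => traj F z u k) (continuous_traj hF u k) hy ?_
  rintro z ⟨n, hn, v, hv, rfl⟩
  exact ⟨n + k, by omega, concat n v u, concat_mem_controls hv hu, (traj_concat_add ..).symm⟩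

/-- A trajectory that starts in a control set and is in it at time `T` has not left it in between:
otherwise the control set could be enlarged by the points visited. -/
theorem IsControlSet.traj_mem [TopologicalSpace X] (hF : ∀ v, Continuous fun x => F x v)
    {D : Set X} (hD : IsControlSet F U D) {x : X} (hx : x ∈ D) {w : ℕ → V} (hw : w ∈ controls U)
    {T : ℕ} (hT : traj F x w T ∈ D) {k : ℕ} (hk : k ≤ T) : traj F x w k ∈ D := by
  obtain ⟨⟨-, hD1, hD2⟩, hmax⟩ := hD
  set E : Set X := D ∪ {y | ∃ j ≤ T, y = traj F x w j} with hE
  have hED : ∀ z ∈ D, E ⊆ closure (reachable F U z) := by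
    rintro z hz y (hy | ⟨j, -, rfl⟩)
    · exact hD1 z hz hy
    · exact traj_mem_closure_reachable hF (hD1 z hz hx) hw j
  have hshift : ∀ j, (fun i => w (j + i)) ∈ controls U := fun j i => hw (j + i)
  have hsub : E ⊆ D := by
    refine hmax ⟨⟨x, Or.inl hx⟩, ?_, ?_⟩ subset_union_left
    · rintro z (hz | ⟨j, hj, rfl⟩)
      · exact hED z hz
      · rcases hj.eq_or_lt with rfl | hj
        · exact hED _ hT
        · refine (hED _ hT).trans (closure_mono (reachable_subset_of_mem ?_))
          refine ⟨T - j, by omega, _, hshift j, ?_⟩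
          rw [← traj_add, Nat.add_sub_cancel' hj.le]
    · rintro z (hz | ⟨j, hj, rfl⟩)
      · obtain ⟨u, hu, h⟩ := hD2 z hz
        exact ⟨u, hu, fun k hk => Or.inl (h k hk)⟩
      · obtain ⟨u, hu, h⟩ := hD2 _ hT
        refine ⟨concat (T - j) (fun i => w (j + i)) u, concat_mem_controls (hshift j) hu, ?_⟩
        intro k _
        rcases le_or_gt k (T - j) with hkT | hkT
        · rw [traj_concat_of_le _ _ _ hkT, ← traj_add]
          exact Or.inr ⟨j + k, by omega, rfl⟩
        · obtain ⟨i, rfl⟩ := Nat.exists_eq_add_of_lt hkT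
          rw [add_assoc, traj_concat_add, ← traj_add, Nat.add_sub_cancel' hj]
          exact Or.inl (h _ (by omega))
  exact hsub (Or.inr ⟨k, hk, rfl⟩)

/-! ### Bounding the total pressure by finite families of blocks -/

theorem aTot_le_card_mul {f : X × V → ℝ} {K Q : Set X} {τ : ℕ} (hK : K.Nonempty)
    (S : Finset (ℕ → V)) {β : ℝ}
    (hS : ∀ u ∈ S, u ∈ controls U)
    (h : ∀ x ∈ K, ∃ u ∈ S, (∀ k ∈ Finset.Icc 1 τ, traj F x u k ∈ Q) ∧
      potentialSum F f τ x u ≤ β) :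
    aTot F U f K Q τ ≤ S.card * ENNReal.ofReal (Real.exp β) := by
  classical
  -- Only controls that serve some point of `K` are kept, so that initial values can be chosen.
  set P : (ℕ → V) → X → Prop := fun u x => x ∈ K ∧ (∀ k ∈ Finset.Icc 1 τ, traj F x u k ∈ Q) ∧
      potentialSum F f τ x u ≤ β with hP
  set S' : Finset (ℕ → V) := S.filter fun u => ∃ x, P u x with hS'
  obtain ⟨x₀, -⟩ := hK
  have hex : ∀ u, ∃ x, u ∈ S' → P u x := fun u => by
    by_cases hu : u ∈ S'
    · exact ((Finset.mem_filter.1 hu).2).imp fun x hx _ => hx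
    · exact ⟨x₀, fun h => (hu h).elim⟩
  choose ξ hξ using hex
  have hT : IsTotallySpanning F U τ K Q ((fun u => (ξ u, u)) '' (S' : Set (ℕ → V))) := by
    refine ⟨S', ⟨fun u hu => hS u (Finset.mem_filter.1 hu).1, fun x hx => ?_⟩, ξ,
      fun u hu => ⟨(hξ u hu).1, (hξ u hu).2.1⟩, rfl⟩
    obtain ⟨u, hu, h1, h2⟩ := h x hx
    exact ⟨u, Finset.mem_coe.2 (Finset.mem_filter.2 ⟨hu, x, hx, h1, h2⟩), h1⟩
  refine (iInf_le _ ⟨_, hT⟩).trans ?_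
  have hinj : InjOn (fun u => (ξ u, u)) (S' : Set (ℕ → V)) := fun u _ v _ huv =>
    (Prod.ext_iff.1 huv).2
  rw [tsum_image (fun p : X × (ℕ → V) =>
    ENNReal.ofReal (Real.exp (potentialSum F f τ p.1 p.2))) hinj,
    Finset.tsum_subtype' S' fun u => ENNReal.ofReal (Real.exp (potentialSum F f τ (ξ u) u))]
  calc ∑ u ∈ S', ENNReal.ofReal (Real.exp (potentialSum F f τ (ξ u) u))
      ≤ ∑ _u ∈ S', ENNReal.ofReal (Real.exp β) := Finset.sum_le_sum fun u hu =>
        ENNReal.ofReal_le_ofReal (Real.exp_le_exp.2 (hξ u hu).2.2)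
    _ = S'.card * ENNReal.ofReal (Real.exp β) := by rw [Finset.sum_const, nsmul_eq_mul]
    _ ≤ S.card * ENNReal.ofReal (Real.exp β) := by
        gcongr
        exact Finset.filter_subset _ _

/-- If the points of `W` can be kept in `Q` for `n` steps and returned to `W` by finitely many
controls, the words of length `j` in these controls keep them in `Q` for `j * n` steps. -/
theorem exists_finset_blocks {f : X × V → ℝ} {W Q : Set X} {n : ℕ} {h : ℕ → ℝ}
    (hh : Function.Periodic h n) (S : Finset (ℕ → V)) (hS : ∀ u ∈ S, u ∈ controls U)
    (hU : (controls U).Nonempty)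
    (hW : ∀ x ∈ W, ∃ u ∈ S, traj F x u n ∈ W ∧
      ∀ k < n, traj F x u k ∈ Q ∧ f (traj F x u k, u k) ≤ h k) (j : ℕ) :
    ∃ S' : Finset (ℕ → V), (∀ u ∈ S', u ∈ controls U) ∧ S'.card ≤ S.card ^ j ∧
      ∀ x ∈ W, ∃ u ∈ S', ∀ k < j * n, traj F x u k ∈ Q ∧ f (traj F x u k, u k) ≤ h k := by
  classical
  induction j with
  | zero =>
    obtain ⟨u, hu⟩ := hU
    exact ⟨{u}, by simpa using hu, by simp, fun x _ => ⟨u, by simp⟩⟩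
  | succ j ih =>
    obtain ⟨S', hS', hcard, hW'⟩ := ih
    refine ⟨(S ×ˢ S').image fun p => concat n p.1 p.2, ?_, ?_, ?_⟩
    · intro u hu
      obtain ⟨p, hp, rfl⟩ := Finset.mem_image.1 hu
      rw [Finset.mem_product] at hp
      exact concat_mem_controls (hS _ hp.1) (hS' _ hp.2)
    · refine Finset.card_image_le.trans ?_
      rw [Finset.card_product, pow_succ']
      gcongr
    · intro x hx
      obtain ⟨v, hv, hvW, hvk⟩ := hW x hx
      obtain ⟨w, hw, hwk⟩ := hW' _ hvW
      refine ⟨concat n v w, Finset.mem_image.2 ⟨(v, w), Finset.mem_product.2 ⟨hv, hw⟩, rfl⟩, ?_⟩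
      intro k hk
      rcases lt_or_ge k n with hkn | hkn
      · rw [traj_concat_of_le _ _ _ hkn.le, concat_of_lt _ _ hkn]
        exact hvk k hkn
      · obtain ⟨i, rfl⟩ := Nat.exists_eq_add_of_le hkn
        rw [traj_concat_add, concat_add, add_comm n i, hh i]
        refine hwk i ?_
        rw [add_mul] at hk
        omega

/-- The partial sums of a periodic sequence stay within a bounded distance of their linear trend. -/
theorem exists_sum_range_le_of_periodic {h : ℕ → ℝ} {n : ℕ} (hn : 0 < n)
    (hh : Function.Periodic h n) :
    ∃ C : ℝ, 0 ≤ C ∧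
      ∀ r : ℕ, ∑ k ∈ Finset.range r, h k ≤ r * ((∑ k ∈ Finset.range n, h k) / n) + C := by
  set a := (∑ k ∈ Finset.range n, h k) / n with ha
  set g : ℕ → ℝ := fun r => ∑ k ∈ Finset.range r, h k - r * a with hg
  have hper : Function.Periodic g n := by
    intro r
    have hn' : (n : ℝ) ≠ 0 := by positivity
    have h1 : ∑ k ∈ Finset.range r, h (n + k) = ∑ k ∈ Finset.range r, h k :=
      Finset.sum_congr rfl fun k _ => by rw [add_comm, hh]
    have h2 : (n : ℝ) * a = ∑ k ∈ Finset.range n, h k := by rw [ha]; field_simp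
    simp only [hg]
    rw [add_comm r n, Finset.sum_range_add, h1]
    push_cast
    linarith
  refine ⟨∑ s ∈ Finset.range n, |g s|, Finset.sum_nonneg fun _ _ => abs_nonneg _, fun r => ?_⟩
  have h3 : g r ≤ ∑ s ∈ Finset.range n, |g s| := by
    rw [← hper.map_mod_nat r]
    exact (le_abs_self _).trans (Finset.single_le_sum (f := fun s => |g s|)
      (fun _ _ => abs_nonneg _) (Finset.mem_range.2 (Nat.mod_lt r hn)))
  simp only [hg] at h3 ⊢
  linarith

/-- Transient followed by blocks: if the points of `K` are brought into `W` by finitely many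
controls `p.2` in times `p.1`, and `W` is kept in `Q` by blocks of length `n` taken from a finite
set `S`, then the total pressure is at most `(log #S) / n` plus the mean of the bound `h` of the
potential along the blocks. -/
theorem totalPressure_le_of_blocks {f : X × V → ℝ} {K W Q : Set X} {n : ℕ} (hn : 0 < n)
    (hK0 : K.Nonempty)
    {h : ℕ → ℝ} (hh : Function.Periodic h n) (S : Finset (ℕ → V))
    (hS : ∀ u ∈ S, u ∈ controls U) (hS0 : S.Nonempty)
    (hW : ∀ x ∈ W, ∃ u ∈ S, traj F x u n ∈ W ∧
      ∀ k < n, traj F x u k ∈ Q ∧ f (traj F x u k, u k) ≤ h k)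
    (P : Finset (ℕ × (ℕ → V))) (hP : ∀ p ∈ P, p.2 ∈ controls U) (c : ℝ)
    (hK : ∀ x ∈ K, ∃ p ∈ P, traj F x p.2 p.1 ∈ W ∧
      ∀ k < p.1, traj F x p.2 k ∈ Q ∧ f (traj F x p.2 k, p.2 k) ≤ c) :
    totalPressure F U f K Q ≤
      ((Real.log S.card / n + (∑ k ∈ Finset.range n, h k) / n : ℝ) : EReal) := by
  classical
  obtain ⟨u₀, hu₀⟩ := hS0
  obtain ⟨C, hC0, hC⟩ := exists_sum_range_le_of_periodic hn hh
  set a := (∑ k ∈ Finset.range n, h k) / n with ha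
  set T := P.sup Prod.fst with hT
  set b : ℝ := T * |c| + T * |a| + C with hb
  have hb0 : 0 ≤ b := by positivity
  have hScard : (1 : ℝ) ≤ S.card := by
    exact_mod_cast Finset.card_pos.2 ⟨u₀, hu₀⟩
  -- `#P` enters through `#P ≤ exp #P`: a constant in the exponent does not affect the growth rate
  have key : ∀ τ : ℕ, aTot F U f K Q τ ≤
      ENNReal.ofReal (Real.exp (P.card + (τ / n + 1 : ℝ) * Real.log S.card + (τ * a + b))) := by
    intro τ
    obtain ⟨S', hS', hcard, hW'⟩ :=
      exists_finset_blocks hh S hS ⟨u₀, hS u₀ hu₀⟩ hW (τ / n + 1)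
    have hτ : τ < (τ / n + 1) * n := Nat.lt_mul_of_div_lt (Nat.lt_succ_self _) hn
    set R : Finset (ℕ → V) := (P ×ˢ S').image fun q => concat q.1.1 q.1.2 q.2 with hR
    have hRcard : (R.card : ℝ) ≤ Real.exp (P.card + (τ / n + 1 : ℝ) * Real.log S.card) := by
      have h1 : R.card ≤ P.card * S.card ^ (τ / n + 1) := by
        refine Finset.card_image_le.trans ?_
        rw [Finset.card_product]
        gcongr
      have h2 : ((S.card ^ (τ / n + 1) : ℕ) : ℝ) ≤
          Real.exp ((τ / n + 1 : ℝ) * Real.log S.card) := by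
        rw [mul_comm, ← Real.rpow_def_of_pos (by linarith)]
        push_cast
        rw [← Real.rpow_natCast]
        refine Real.rpow_le_rpow_of_exponent_le hScard ?_
        push_cast
        gcongr
        exact Nat.cast_div_le
      rw [Real.exp_add]
      calc (R.card : ℝ) ≤ (P.card : ℝ) * ((S.card ^ (τ / n + 1) : ℕ) : ℝ) := by exact_mod_cast h1
        _ ≤ _ := by
          gcongr
          exact (by linarith : (P.card : ℝ) ≤ P.card + 1).trans (Real.add_one_le_exp _)
    refine (aTot_le_card_mul hK0 R (β := τ * a + b) ?_ ?_).trans ?_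
    · intro u hu
      obtain ⟨q, hq, rfl⟩ := Finset.mem_image.1 hu
      rw [Finset.mem_product] at hq
      exact concat_mem_controls (hP _ hq.1) (hS' _ hq.2)
    · intro x hx
      obtain ⟨⟨t, w⟩, hp, hpW, hpk⟩ := hK x hx
      obtain ⟨v, hv, hvk⟩ := hW' _ hpW
      have htT : t ≤ T := Finset.le_sup (f := Prod.fst) hp
      simp only at hpW hpk hvk
      have hQ : ∀ k ≤ τ, traj F x (concat t w v) k ∈ Q := by
        intro k hk
        rcases lt_or_ge k t with hkt | hkt
        · rw [traj_concat_of_le _ _ _ hkt.le]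
          exact (hpk k hkt).1
        · obtain ⟨i, rfl⟩ := Nat.exists_eq_add_of_le hkt
          rw [traj_concat_add]
          exact (hvk i (by omega)).1
      refine ⟨concat t w v, Finset.mem_image.2 ⟨((t, w), v), Finset.mem_product.2 ⟨hp, hv⟩, rfl⟩,
        fun k hk => hQ k (Finset.mem_Icc.1 hk).2, ?_⟩
      have hpre : ∀ s ≤ t, ∑ k ∈ Finset.range s,
          f (traj F x (concat t w v) k, concat t w v k) ≤ T * |c| := by
        intro s hs
        calc _ ≤ ∑ _k ∈ Finset.range s, |c| := by
              refine Finset.sum_le_sum fun k hk => ?_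
              have hk' : k < t := (Finset.mem_range.1 hk).trans_le hs
              rw [traj_concat_of_le _ _ _ hk'.le, concat_of_lt _ _ hk']
              exact (hpk k hk').2.trans (le_abs_self c)
          _ = s * |c| := by simp
          _ ≤ T * |c| := by
              gcongr
              exact hs.trans htT
      unfold potentialSum
      have hTr : (t : ℝ) ≤ T := by exact_mod_cast htT
      rcases le_or_gt τ t with hτt | hτt
      · have h1 : -(τ * a) ≤ T * |a| := by
          have : (τ : ℝ) ≤ T := by exact_mod_cast hτt.trans htT
          calc -((τ : ℝ) * a) = τ * -a := by ring
            _ ≤ τ * |a| := by gcongr; exact neg_le_abs a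
            _ ≤ _ := by gcongr
        have := hpre τ hτt
        linarith
      · obtain ⟨i, rfl⟩ := Nat.exists_eq_add_of_lt hτt
        rw [add_assoc, Finset.sum_range_add]
        have h1 := hpre t le_rfl
        have h2 : ∑ k ∈ Finset.range (i + 1),
            f (traj F x (concat t w v) (t + k), concat t w v (t + k)) ≤
              ((i + 1 : ℕ) : ℝ) * a + C := by
          refine le_trans (Finset.sum_le_sum fun k hk => ?_) (hC (i + 1))
          rw [traj_concat_add, concat_add]
          refine (hvk k ?_).2
          have := Finset.mem_range.1 hk
          omega
        have h3 : -(t * a) ≤ T * |a| := by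
          calc -((t : ℝ) * a) = t * -a := by ring
            _ ≤ t * |a| := by gcongr; exact neg_le_abs a
            _ ≤ _ := by gcongr
        push_cast at h2 ⊢
        linarith
    · rw [Real.exp_add (_ + _), ENNReal.ofReal_mul (Real.exp_pos _).le]
      gcongr
      rw [← ENNReal.ofReal_natCast]
      exact ENNReal.ofReal_le_ofReal hRcard
  have hlog : ∀ τ : ℕ, (((τ : ℝ)⁻¹ : ℝ) : EReal) * ENNReal.log (aTot F U f K Q τ) ≤
      (((τ : ℝ)⁻¹ * (P.card + (τ / n + 1 : ℝ) * Real.log S.card + (τ * a + b)) : ℝ) : EReal) := by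
    intro τ
    rw [EReal.coe_mul]
    refine mul_le_mul_of_nonneg_left ?_ (EReal.coe_nonneg.2 (by positivity))
    refine (ENNReal.log_monotone (key τ)).trans ?_
    rw [ENNReal.log_ofReal_of_pos (Real.exp_pos _), Real.log_exp]
  have hlim : Tendsto (fun τ : ℕ => (τ : ℝ)⁻¹ *
      (P.card + (τ / n + 1 : ℝ) * Real.log S.card + (τ * a + b))) atTop
      (𝓝 (Real.log S.card / n + a)) := by
    have h1 : Tendsto (fun τ : ℕ => (Real.log S.card / n + a) +
        (τ : ℝ)⁻¹ * (P.card + Real.log S.card + b)) atTop (𝓝 (Real.log S.card / n + a)) := by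
      simpa using (tendsto_inv_atTop_nhds_zero_nat (𝕜 := ℝ)).mul_const
        (P.card + Real.log S.card + b) |>.const_add (Real.log S.card / n + a)
    refine h1.congr' ?_
    filter_upwards [eventually_gt_atTop 0] with τ hτ
    have : (τ : ℝ) ≠ 0 := by positivity
    have : (n : ℝ) ≠ 0 := by positivity
    field_simp
    ring
  exact (limsup_le_limsup (Eventually.of_forall hlog)).trans
    ((continuous_coe_real_ereal.tendsto _).comp hlim).limsup_eq.le

end General

/-! ### Powers of matrices with spectrum off the unit circle -/

section Spectral

attribute [local instance] Matrix.linftyOpNormedAddCommGroup Matrix.linftyOpNormedSpace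
  Matrix.linftyOpNormedRing Matrix.linftyOpNormedAlgebra

/-- A consequence of Gelfand's formula for the spectral radius. -/
theorem tendsto_norm_pow_of_spectrum_lt_one {a : ℕ} (M : Matrix (Fin a) (Fin a) ℂ)
    (hM : ∀ z ∈ spectrum ℂ M, ‖z‖ < 1) : Tendsto (fun k : ℕ => ‖M ^ k‖) atTop (𝓝 0) := by
  rcases subsingleton_or_nontrivial (Matrix (Fin a) (Fin a) ℂ) with hs | hs
  · have : (fun k : ℕ => ‖M ^ k‖) = fun _ => 0 := by
      funext k
      rw [Subsingleton.elim (M ^ k) 0, norm_zero]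
    rw [this]
    exact tendsto_const_nhds
  have : CompleteSpace (Matrix (Fin a) (Fin a) ℂ) := FiniteDimensional.complete ℂ _
  have hr : spectralRadius ℂ M < ((1 : NNReal) : ENNReal) :=
    spectrum.spectralRadius_lt_of_forall_lt M fun z hz => by exact_mod_cast hM z hz
  obtain ⟨r, hr1, hr2⟩ := ENNReal.lt_iff_exists_nnreal_btwn.1 hr
  have hr2' : r < 1 := by exact_mod_cast hr2
  have hlim := spectrum.pow_nnnorm_pow_one_div_tendsto_nhds_spectralRadius M
  have hev : ∀ᶠ k : ℕ in atTop, ‖M ^ k‖ ≤ (r : ℝ) ^ k := by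
    filter_upwards [hlim.eventually_lt_const hr1, eventually_gt_atTop 0] with k hk hk0
    have hk' : (k : ℝ) ≠ 0 := by positivity
    have h1 : ((‖M ^ k‖₊ : ENNReal) ^ (1 / (k : ℝ))) ^ (k : ℝ) ≤ (r : ENNReal) ^ (k : ℝ) :=
      ENNReal.rpow_le_rpow hk.le (by positivity)
    rw [← ENNReal.rpow_mul, one_div, inv_mul_cancel₀ hk', ENNReal.rpow_one,
      ENNReal.rpow_natCast] at h1
    exact_mod_cast h1
  exact squeeze_zero' (Eventually.of_forall fun k => norm_nonneg _) hev
    (tendsto_pow_atTop_nhds_zero_of_lt_one r.2 hr2')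

theorem norm_map_ofReal {a : ℕ} (M : Matrix (Fin a) (Fin a) ℝ) :
    ‖M.map (algebraMap ℝ ℂ)‖ = ‖M‖ := by
  simp [Matrix.linfty_opNorm_def]

theorem tendsto_norm_pow_of_spectrum_map_lt_one {a : ℕ} (M : Matrix (Fin a) (Fin a) ℝ)
    (hM : ∀ z ∈ spectrum ℂ (M.map (algebraMap ℝ ℂ)), ‖z‖ < 1) :
    Tendsto (fun k : ℕ => ‖M ^ k‖) atTop (𝓝 0) := by
  refine (tendsto_norm_pow_of_spectrum_lt_one _ hM).congr fun k => ?_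
  rw [← norm_map_ofReal, ← RingHom.mapMatrix_apply, ← RingHom.mapMatrix_apply, map_pow]

theorem exists_norm_pow_mulVec_le {a : ℕ} (M : Matrix (Fin a) (Fin a) ℝ)
    (hM : ∀ z ∈ spectrum ℂ (M.map (algebraMap ℝ ℂ)), ‖z‖ < 1) :
    (∃ C, 0 ≤ C ∧ ∀ (k : ℕ) (x : Fin a → ℝ), ‖(M ^ k).mulVec x‖ ≤ C * ‖x‖) ∧
      ∀ᶠ k : ℕ in atTop, ∀ x : Fin a → ℝ, ‖(M ^ k).mulVec x‖ ≤ ‖x‖ := by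
  have h := tendsto_norm_pow_of_spectrum_map_lt_one M hM
  constructor
  · obtain ⟨C, hC⟩ := h.bddAbove_range
    have hC' : ∀ k : ℕ, ‖M ^ k‖ ≤ C := fun k => hC ⟨k, rfl⟩
    refine ⟨C, (norm_nonneg _).trans (hC' 0), fun k x => ?_⟩
    exact (Matrix.linfty_opNorm_mulVec _ _).trans (by gcongr; exact hC' k)
  · filter_upwards [h.eventually_le_const one_pos] with k hk x
    refine (Matrix.linfty_opNorm_mulVec _ _).trans ?_
    exact mul_le_of_le_one_left (norm_nonneg _) hk

/-- Expanding matrices: the inverse has its spectrum inside the unit disc, so its powers are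
bounded. -/
theorem exists_norm_le_pow_mulVec {a : ℕ} (M : Matrix (Fin a) (Fin a) ℝ)
    (hM : ∀ z ∈ spectrum ℂ (M.map (algebraMap ℝ ℂ)), 1 < ‖z‖) :
    IsUnit M.det ∧
      ∃ C, 0 ≤ C ∧ ∀ (k : ℕ) (x : Fin a → ℝ), ‖x‖ ≤ C * ‖(M ^ k).mulVec x‖ := by
  have h0 : IsUnit (M.map (algebraMap ℝ ℂ)) := by
    rw [← spectrum.zero_notMem_iff ℂ]
    intro h
    have := hM 0 h
    rw [norm_zero] at this
    linarith
  have hdet : IsUnit M.det := by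
    rw [Matrix.isUnit_iff_isUnit_det, ← RingHom.mapMatrix_apply, ← RingHom.map_det] at h0
    rw [isUnit_iff_ne_zero] at h0 ⊢
    exact fun h => h0 (by rw [h, map_zero])
  refine ⟨hdet, ?_⟩
  have hinv : ∀ z ∈ spectrum ℂ ((M⁻¹).map (algebraMap ℝ ℂ)), ‖z‖ < 1 := by
    intro z hz
    set w : (Matrix (Fin a) (Fin a) ℂ)ˣ :=
      Units.map ((algebraMap ℝ ℂ).mapMatrix : Matrix (Fin a) (Fin a) ℝ →+* _).toMonoidHom
        (M.nonsingInvUnit hdet) with hw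
    have hz' : z ∈ spectrum ℂ ((w⁻¹ : (Matrix (Fin a) (Fin a) ℂ)ˣ) : Matrix (Fin a) (Fin a) ℂ) := hz
    rw [← spectrum.map_inv, Set.mem_inv] at hz'
    have h1 := hM z⁻¹ hz'
    rw [norm_inv] at h1
    exact (one_lt_inv_iff₀.1 h1).2
  obtain ⟨⟨C, hC0, hC⟩, -⟩ := exists_norm_pow_mulVec_le M⁻¹ hinv
  refine ⟨C, hC0, fun k x => ?_⟩
  have h2 := hC k ((M ^ k).mulVec x)
  rwa [Matrix.mulVec_mulVec, Matrix.inv_pow', Matrix.nonsing_inv_mul _ (by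
    rw [Matrix.det_pow]; exact hdet.pow k), Matrix.one_mulVec] at h2

end Spectral

/-! ### The splitting into the unstable and the stable subspace -/

section Splitting

open Polynomial

/-- The only automorphisms of `ℂ` over `ℝ` are the identity and the conjugation. -/
theorem norm_eq_of_irreducible {q : ℝ[X]} (hq : Irreducible q) {z w : ℂ}
    (hz : aeval z q = 0) (hw : aeval w q = 0) : ‖w‖ = ‖z‖ := by
  have : IsAlgClosure ℝ ℂ := ⟨inferInstance, inferInstance⟩
  have : Normal ℝ ℂ := IsAlgClosure.normal ℝ ℂ
  have h : IsConjRoot ℝ z w := by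
    rw [IsConjRoot, ← minpoly.eq_of_irreducible hq hz, ← minpoly.eq_of_irreducible hq hw]
  obtain ⟨σ, rfl⟩ := isConjRoot_iff_exists_algEquiv.1 h
  rcases Complex.real_algHom_eq_id_or_conj (σ : ℂ →ₐ[ℝ] ℂ) with hσ | hσ
  · have : σ w = w := DFunLike.congr_fun hσ w
    rw [this]
  · have : σ w = (starRingEnd ℂ) w := DFunLike.congr_fun hσ w
    rw [this, RCLike.norm_conj]

/-- A real polynomial without roots on the unit circle is the product of real polynomials with the
roots outside and inside the unit disc. -/
theorem exists_factor_outside_inside (p : ℝ[X]) (hp0 : p ≠ 0)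
    (hp : ∀ z : ℂ, aeval z p = 0 → ‖z‖ ≠ 1) :
    ∃ q r : ℝ[X], p = q * r ∧ (∀ z : ℂ, aeval z q = 0 → 1 < ‖z‖) ∧
      ∀ z : ℂ, aeval z r = 0 → ‖z‖ < 1 := by
  induction p using WfDvdMonoid.induction_on_irreducible with
  | zero => exact absurd rfl hp0
  | unit u hu =>
    refine ⟨u, 1, (mul_one u).symm, fun z hz => ?_, fun z hz => by simp at hz⟩
    exact absurd hz (hu.map (aeval z)).ne_zero
  | mul p i hp' hi ih =>
    obtain ⟨q, r, rfl, hq, hr⟩ := ih hp' fun z hz => hp z (by rw [map_mul, hz, mul_zero])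
    have hi1 : ∀ z : ℂ, aeval z i = 0 → ‖z‖ ≠ 1 := fun z hz =>
      hp z (by rw [map_mul, hz, zero_mul])
    by_cases h : ∃ z : ℂ, aeval z i = 0 ∧ 1 < ‖z‖
    · obtain ⟨z, hz, hz1⟩ := h
      refine ⟨i * q, r, by ring, fun w hw => ?_, hr⟩
      rw [map_mul, mul_eq_zero] at hw
      rcases hw with hw | hw
      · rwa [norm_eq_of_irreducible hi hz hw]
      · exact hq w hw
    · push Not at h
      refine ⟨q, i * r, by ring, hq, fun w hw => ?_⟩
      rw [map_mul, mul_eq_zero] at hw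
      rcases hw with hw | hw
      · exact (h w hw).lt_of_ne (hi1 w hw)
      · exact hr w hw

theorem aeval_eq_zero_of_mem_spectrum {a : ℕ} {M : Matrix (Fin a) (Fin a) ℝ} {q : ℝ[X]}
    (hq : aeval M q = 0) {z : ℂ} (hz : z ∈ spectrum ℂ (M.map (algebraMap ℝ ℂ))) :
    aeval z q = 0 := by
  have h1 : aeval (M.map (algebraMap ℝ ℂ)) q = 0 := by
    have := aeval_algHom_apply ((Algebra.ofId ℝ ℂ).mapMatrix (m := Fin a)) M q
    rw [hq, map_zero] at this
    exact this
  have h2 := spectrum.subset_polynomial_aeval (M.map (algebraMap ℝ ℂ)) (q.map (algebraMap ℝ ℂ))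
    ⟨z, hz, rfl⟩
  rw [aeval_map_algebraMap, h1] at h2
  rcases subsingleton_or_nontrivial (Matrix (Fin a) (Fin a) ℂ) with hs | hs
  · simp [spectrum.of_subsingleton] at h2
  · rw [spectrum.zero_eq, mem_singleton_iff] at h2
    simpa [eval_map_algebraMap] using h2

/-- In suitable coordinates a hyperbolic matrix is a product of an expanding matrix `M` and a
contracting matrix `N`, and `M` carries the unstable determinant. The coordinates come from the
kernels of the two factors of the characteristic polynomial evaluated at `A`. -/
theorem exists_hyperbolic_splitting {d : ℕ} (A : Matrix (Fin d) (Fin d) ℝ) (hA : IsHyperbolic A) :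
    ∃ (a b : ℕ) (M : Matrix (Fin a) (Fin a) ℝ) (N : Matrix (Fin b) (Fin b) ℝ)
      (e : (Fin d → ℝ) ≃ₗ[ℝ] (Fin a → ℝ) × (Fin b → ℝ)),
      (∀ x, e (A.mulVec x) = (M.mulVec (e x).1, N.mulVec (e x).2)) ∧
      (∀ z ∈ spectrum ℂ (M.map (algebraMap ℝ ℂ)), 1 < ‖z‖) ∧
      (∀ z ∈ spectrum ℂ (N.map (algebraMap ℝ ℂ)), ‖z‖ < 1) ∧
      ‖unstableDet A‖ = |M.det| := by
  classical
  obtain ⟨q, r, hqr, hq, hr⟩ := exists_factor_outside_inside A.charpoly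
    A.charpoly_monic.ne_zero fun z hz => hA z (by
      rw [Matrix.mem_spectrum_iff_isRoot_charpoly, Matrix.charpoly_map, IsRoot,
        eval_map_algebraMap, hz])
  set L := Matrix.toLin' A with hL
  have hcop : IsCoprime q r := by
    rw [isCoprime_iff_aeval_ne_zero_of_isAlgClosed ℝ ℂ]
    intro z
    by_contra! h
    exact lt_asymm (hq z h.1) (hr z h.2)
  have hcompl : IsCompl (aeval L q).ker (aeval L r).ker := by
    refine ⟨disjoint_ker_aeval_of_isCoprime L hcop, codisjoint_iff.2 ?_⟩
    rw [sup_ker_aeval_eq_ker_aeval_mul_of_coprime L hcop, ← hqr, ← Matrix.charpoly_toLin' A,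
      LinearMap.aeval_self_charpoly, LinearMap.ker_zero]
  have hinv : ∀ p : ℝ[X], ∀ x ∈ (aeval L p).ker, L x ∈ (aeval L p).ker := by
    intro p x hx
    have hc : aeval L p * L = L * aeval L p := by
      simpa only [map_mul, aeval_X] using congrArg (aeval L) (mul_comm p X)
    rw [LinearMap.mem_ker] at hx ⊢
    rw [← Module.End.mul_apply, hc, Module.End.mul_apply, hx, map_zero]
  have hres : ∀ p : ℝ[X], aeval (L.restrict (hinv p)) p = 0 := by
    intro p
    have hcoe : ∀ (s : ℝ[X]) (x : (aeval L p).ker),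
        (aeval (L.restrict (hinv p)) s x : Fin d → ℝ) = aeval L s x := by
      intro s x
      induction s using Polynomial.induction_on' with
      | add s t hs ht => simp only [map_add, LinearMap.add_apply, Submodule.coe_add, hs, ht]
      | monomial n c =>
        simp only [aeval_monomial, Module.End.mul_apply, Module.algebraMap_end_apply,
          Submodule.coe_smul, Module.End.pow_restrict n]
        rfl
    refine LinearMap.ext fun x => Subtype.ext ?_
    rw [hcoe]
    exact x.2
  set Lu := L.restrict (hinv q) with hLu
  set Ls := L.restrict (hinv r) with hLs
  set bu := Module.finBasis ℝ (aeval L q).ker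
  set bs := Module.finBasis ℝ (aeval L r).ker
  set M := LinearMap.toMatrix bu bu Lu with hM
  set N := LinearMap.toMatrix bs bs Ls with hN
  set e₀ := Submodule.prodEquivOfIsCompl _ _ hcompl with he₀
  have hconj : ∀ y, e₀ ((Lu.prodMap Ls) y) = L (e₀ y) := by
    intro y
    simp [he₀, hLu, hLs, LinearMap.restrict_apply]
  have hM1 : ∀ z ∈ spectrum ℂ (M.map (algebraMap ℝ ℂ)), 1 < ‖z‖ := fun z hz =>
    hq z (aeval_eq_zero_of_mem_spectrum (by
      have := aeval_algHom_apply (LinearMap.toMatrixAlgEquiv bu).toAlgHom Lu q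
      rw [hres, map_zero] at this
      exact this) hz)
  have hN1 : ∀ z ∈ spectrum ℂ (N.map (algebraMap ℝ ℂ)), ‖z‖ < 1 := fun z hz =>
    hr z (aeval_eq_zero_of_mem_spectrum (by
      have := aeval_algHom_apply (LinearMap.toMatrixAlgEquiv bs).toAlgHom Ls r
      rw [hres, map_zero] at this
      exact this) hz)
  refine ⟨_, _, M, N, e₀.symm.trans (LinearEquiv.prodCongr bu.equivFun bs.equivFun), ?_, hM1, hN1,
    ?_⟩
  · intro x
    obtain ⟨y, rfl⟩ := e₀.surjective x
    have h1 : e₀.symm (A.mulVec (e₀ y)) = (Lu.prodMap Ls) y := by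
      rw [LinearEquiv.symm_apply_eq, hconj]
      rfl
    simp only [LinearEquiv.trans_apply, h1, LinearEquiv.symm_apply_apply,
      LinearEquiv.prodCongr_apply, LinearMap.prodMap_apply]
    ext i
    · simp [hM, LinearMap.toMatrix_mulVec_repr]
    · simp [hN, LinearMap.toMatrix_mulVec_repr]
  · have hchar : A.charpoly = M.charpoly * N.charpoly := by
      have h2 : e₀.conj (Lu.prodMap Ls) = L := by
        refine LinearMap.ext fun x => ?_
        obtain ⟨y, rfl⟩ := e₀.surjective x
        rw [LinearEquiv.conj_apply_apply, LinearEquiv.symm_apply_apply, hconj]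
      have h3 := LinearEquiv.charpoly_conj e₀ (Lu.prodMap Ls)
      rwa [h2, LinearMap.charpoly_prodMap, ← LinearMap.charpoly_toMatrix Lu bu,
        ← LinearMap.charpoly_toMatrix Ls bs, Matrix.charpoly_toLin'] at h3
    have hroots : eigenvaluesC A = (M.map (algebraMap ℝ ℂ)).charpoly.roots +
        (N.map (algebraMap ℝ ℂ)).charpoly.roots := by
      rw [eigenvaluesC, Matrix.charpoly_map, hchar, Polynomial.map_mul, ← Matrix.charpoly_map,
        ← Matrix.charpoly_map, roots_mul]
      exact mul_ne_zero (Matrix.charpoly_monic _).ne_zero (Matrix.charpoly_monic _).ne_zero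
    have hmem : ∀ {a : ℕ} (R : Matrix (Fin a) (Fin a) ℂ) (z : ℂ), z ∈ R.charpoly.roots →
        z ∈ spectrum ℂ R := fun R z hz =>
      Matrix.mem_spectrum_iff_isRoot_charpoly.2 (mem_roots'.1 hz).2
    rw [unstableDet, hroots, Multiset.filter_add,
      Multiset.filter_eq_self.2 fun z hz => hM1 z (hmem _ z hz),
      Multiset.filter_eq_nil.2 fun z hz => (hN1 z (hmem _ z hz)).le.not_gt, add_zero,
      ← Matrix.det_eq_prod_roots_charpoly, ← RingHom.mapMatrix_apply, ← RingHom.map_det]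
    simp

end Splitting

/-! ### Covering the unit ball by preimages of balls -/

section Packing

open MeasureTheory

/-- The preimages under `M` of the balls of radius `1 / 2` around the points `M c`, `c ∈ S`, are
disjoint, of volume `|det M|⁻¹`, and contained in the ball of radius `2 + C`. -/
theorem card_le_of_separated {a : ℕ} (M : Matrix (Fin a) (Fin a) ℝ) (hM : M.det ≠ 0) {C : ℝ}
    (hC0 : 0 ≤ C) (hC : ∀ x, ‖x‖ ≤ C * ‖M.mulVec x‖) (S : Finset (Fin a → ℝ))
    (hS : ∀ c ∈ S, ‖c‖ ≤ 1) (hsep : ∀ c ∈ S, ∀ c' ∈ S, c ≠ c' → 1 < ‖M.mulVec (c - c')‖) :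
    (S.card : ℝ) ≤ (2 * (2 + C)) ^ a * |M.det| := by
  set L := Matrix.toLin' M with hL
  have hdet : LinearMap.det L = M.det := LinearMap.det_toLin' M
  have hvol : ∀ c, volume (L ⁻¹' Metric.ball (L c) (1 / 2)) = ENNReal.ofReal |(M.det)⁻¹| := by
    intro c
    rw [Measure.addHaar_preimage_linearMap volume (by rwa [hdet]), Real.volume_pi_ball _ (by norm_num),
      hdet]
    simp
  have hsub : (⋃ c ∈ S, L ⁻¹' Metric.ball (L c) (1 / 2)) ⊆ Metric.ball 0 (2 + C) := by
    refine iUnion₂_subset fun c hc x hx => ?_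
    rw [mem_preimage, mem_ball_iff_norm, ← map_sub] at hx
    rw [mem_ball_zero_iff]
    have h1 := hC (x - c)
    have h2 : C * ‖M.mulVec (x - c)‖ ≤ C * 1 := by
      gcongr
      exact (hx.trans (by norm_num)).le
    have h3 := norm_le_norm_add_norm_sub' x c
    have h4 := hS c hc
    linarith
  have hdisj : (S : Set (Fin a → ℝ)).PairwiseDisjoint fun c => L ⁻¹' Metric.ball (L c) (1 / 2) := by
    intro c hc c' hc' hne
    refine Disjoint.preimage _ (Metric.ball_disjoint_ball ?_)
    rw [dist_eq_norm, ← map_sub]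
    have := hsep c hc c' hc' hne
    simp only [hL, Matrix.toLin'_apply]
    linarith
  have hmeas := measure_mono (μ := volume) hsub
  rw [measure_biUnion_finset hdisj fun c _ =>
    (L.continuous_of_finiteDimensional.measurable Metric.isOpen_ball.measurableSet),
    Finset.sum_congr rfl fun c _ => hvol c, Finset.sum_const, nsmul_eq_mul,
    Real.volume_pi_ball _ (by linarith), ← ENNReal.ofReal_natCast,
    ← ENNReal.ofReal_mul (by positivity), ENNReal.ofReal_le_ofReal_iff (by positivity),
    abs_inv, ← div_eq_mul_inv, div_le_iff₀ (abs_pos.2 hM), Fintype.card_fin] at hmeas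
  exact hmeas

/-- The centers are a maximal subset of the unit ball whose images under `M` have mutual distances
greater than `1`; comparing volumes bounds their number by a multiple of `|det M|`. -/
theorem exists_centers {a : ℕ} (M : Matrix (Fin a) (Fin a) ℝ) (hM : M.det ≠ 0) {C : ℝ}
    (hC0 : 0 ≤ C) (hC : ∀ x, ‖x‖ ≤ C * ‖M.mulVec x‖) :
    ∃ S : Finset (Fin a → ℝ), (S.card : ℝ) ≤ (2 * (2 + C)) ^ a * |M.det| ∧ (∀ c ∈ S, ‖c‖ ≤ 1) ∧
      ∀ x, ‖x‖ ≤ 1 → ∃ c ∈ S, ‖M.mulVec (x - c)‖ ≤ 1 := by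
  classical
  by_contra! hcon
  have hind : ∀ k : ℕ, ∃ S : Finset (Fin a → ℝ), S.card = k ∧ (∀ c ∈ S, ‖c‖ ≤ 1) ∧
      ∀ c ∈ S, ∀ c' ∈ S, c ≠ c' → 1 < ‖M.mulVec (c - c')‖ := by
    intro k
    induction k with
    | zero => exact ⟨∅, by simp⟩
    | succ k ih =>
      obtain ⟨S, hcard, hS, hsep⟩ := ih
      obtain ⟨x, hx, hxS⟩ := hcon S (card_le_of_separated M hM hC0 hC S hS hsep) hS
      have hxn : x ∉ S := fun h => by
        have := hxS x h
        rw [sub_self, Matrix.mulVec_zero, norm_zero] at this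
        linarith
      refine ⟨insert x S, by rw [Finset.card_insert_of_notMem hxn, hcard], ?_, ?_⟩
      · intro c hc
        rcases Finset.mem_insert.1 hc with rfl | hc
        · exact hx
        · exact hS c hc
      · intro c hc c' hc' hne
        rcases Finset.mem_insert.1 hc with rfl | hcS <;>
          rcases Finset.mem_insert.1 hc' with rfl | hcS'
        · exact absurd rfl hne
        · exact hxS c' hcS'
        · rw [← neg_sub, Matrix.mulVec_neg, norm_neg]
          exact hxS c hcS
        · exact hsep c hcS c' hcS' hne
  obtain ⟨S, hcard, hS, hsep⟩ := hind (⌊(2 * (2 + C)) ^ a * |M.det|⌋₊ + 1)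
  have h1 := card_le_of_separated M hM hC0 hC S hS hsep
  have h2 := Nat.lt_floor_add_one ((2 * (2 + C)) ^ a * |M.det|)
  rw [hcard] at h1
  push_cast at h1
  linarith

end Packing

/-! ### Steering to the origin -/

section Linear

variable {d m : ℕ}

theorem traj_linSys_add (A : Matrix (Fin d) (Fin d) ℝ) (B : Matrix (Fin d) (Fin m) ℝ)
    (x y : Fin d → ℝ) (u v : ℕ → Fin m → ℝ) (k : ℕ) :
    traj (linSys A B) (x + y) (u + v) k =
      traj (linSys A B) x u k + traj (linSys A B) y v k := by
  induction k with
  | zero => rfl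
  | succ k ih =>
    simp only [traj, ih, linSys, Pi.add_apply, Matrix.mulVec_add]
    abel

theorem traj_linSys_smul (A : Matrix (Fin d) (Fin d) ℝ) (B : Matrix (Fin d) (Fin m) ℝ) (b : ℝ)
    (x : Fin d → ℝ) (u : ℕ → Fin m → ℝ) (k : ℕ) :
    traj (linSys A B) (b • x) (b • u) k = b • traj (linSys A B) x u k := by
  induction k with
  | zero => rfl
  | succ k ih => simp only [traj, ih, linSys, Pi.smul_apply, Matrix.mulVec_smul, smul_add]

theorem traj_linSys_zero (A : Matrix (Fin d) (Fin d) ℝ) (B : Matrix (Fin d) (Fin m) ℝ)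
    (x : Fin d → ℝ) (k : ℕ) : traj (linSys A B) x 0 k = (A ^ k).mulVec x := by
  induction k with
  | zero => simp [traj]
  | succ k ih =>
    simp only [traj, ih, linSys, Pi.zero_apply, Matrix.mulVec_zero, add_zero,
      Matrix.mulVec_mulVec, pow_succ']

theorem traj_linSys_eq_sum (A : Matrix (Fin d) (Fin d) ℝ) (B : Matrix (Fin d) (Fin m) ℝ)
    (x : Fin d → ℝ) (u : ℕ → Fin m → ℝ) (n : ℕ) :
    traj (linSys A B) x u n = (A ^ n).mulVec x +
      ∑ j ∈ Finset.range n, (A ^ j * B).mulVec (u (n - 1 - j)) := by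
  induction n with
  | zero => simp [traj]
  | succ n ih =>
    rw [traj, ih, linSys, Finset.sum_range_succ', Matrix.mulVec_add, Matrix.mulVec_mulVec,
      ← pow_succ', Matrix.mulVec_sum, add_assoc]
    congr 2
    · refine Finset.sum_congr rfl fun j hj => ?_
      rw [Matrix.mulVec_mulVec, ← Matrix.mul_assoc, ← pow_succ']
      congr 2
      omega
    · simp

theorem continuous_linSys (A : Matrix (Fin d) (Fin d) ℝ) (B : Matrix (Fin d) (Fin m) ℝ)
    (u : Fin m → ℝ) : Continuous fun x => linSys A B x u := by
  unfold linSys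
  fun_prop

theorem exists_norm_mulVec_le {a b : ℕ} (M : Matrix (Fin a) (Fin b) ℝ) :
    ∃ C, 0 ≤ C ∧ ∀ x, ‖M.mulVec x‖ ≤ C * ‖x‖ :=
  ⟨_, norm_nonneg _, fun x => (LinearMap.toContinuousLinearMap (Matrix.toLin' M)).le_opNorm x⟩

/-- For a controllable pair every state is steered to the origin in `d` steps, by a control that is,
together with its trajectory, bounded by a multiple of the norm of the state. -/
theorem IsControllablePair.exists_null_control {A : Matrix (Fin d) (Fin d) ℝ}
    {B : Matrix (Fin d) (Fin m) ℝ} (hAB : IsControllablePair A B) :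
    ∃ C, 0 ≤ C ∧ ∀ c : Fin d → ℝ, ∃ v : ℕ → Fin m → ℝ, ∀ k, ‖v k‖ ≤ C * ‖c‖ ∧
      ‖traj (linSys A B) c v k‖ ≤ C * ‖c‖ ∧ (d ≤ k → traj (linSys A B) c v k = 0) := by
  have hsurj : LinearMap.range (kalmanMatrix A B).mulVecLin = ⊤ := by
    apply Submodule.eq_top_of_finrank_eq
    rw [Module.finrank_fin_fun]
    exact hAB
  obtain ⟨G, hG⟩ := LinearMap.exists_rightInverse_of_surjective _ hsurj
  obtain ⟨CA, hCA0, hCA⟩ := exists_norm_mulVec_le A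
  obtain ⟨CB, hCB0, hCB⟩ := exists_norm_mulVec_le B
  obtain ⟨Cd, hCd0, hCd⟩ := exists_norm_mulVec_le (A ^ d)
  set CG := ‖LinearMap.toContinuousLinearMap G‖ with hCG
  have hGle : ∀ x, ‖G x‖ ≤ CG * ‖x‖ := (LinearMap.toContinuousLinearMap G).le_opNorm
  set C₁ := CG * Cd with hC₁
  have hC₁0 : 0 ≤ C₁ := by positivity
  set s := CA + CB * C₁ + 1 with hs
  have hs1 : 1 ≤ s := by
    have : 0 ≤ CB * C₁ := by positivity
    linarith
  refine ⟨C₁ + s ^ d, by positivity, fun c => ?_⟩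
  set w := G (-(A ^ d).mulVec c) with hw
  have hwC : ‖w‖ ≤ C₁ * ‖c‖ := by
    refine (hGle _).trans ?_
    rw [norm_neg, hC₁, mul_assoc]
    gcongr
    exact hCd c
  set v : ℕ → Fin m → ℝ := fun k => if h : k < d then fun i => w (⟨d - 1 - k, by omega⟩, i) else 0
    with hv
  have hvC : ∀ k, ‖v k‖ ≤ C₁ * ‖c‖ := by
    intro k
    refine le_trans ?_ hwC
    simp only [hv]
    split_ifs
    · exact (pi_norm_le_iff_of_nonneg (norm_nonneg _)).2 fun i => norm_le_pi_norm w _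
    · simp
  have hd : traj (linSys A B) c v d = 0 := by
    have h1 : (kalmanMatrix A B).mulVec w = -(A ^ d).mulVec c :=
      LinearMap.congr_fun hG (-(A ^ d).mulVec c)
    have h2 : ∑ j ∈ Finset.range d, (A ^ j * B).mulVec (v (d - 1 - j)) =
        (kalmanMatrix A B).mulVec w := by
      ext i
      simp only [Finset.sum_apply, Matrix.mulVec, dotProduct, kalmanMatrix, Matrix.of_apply,
        Fintype.sum_prod_type, Finset.sum_range]
      refine Finset.sum_congr rfl fun j _ => Finset.sum_congr rfl fun l _ => ?_
      have hj : d - 1 - (d - 1 - (j : ℕ)) = j := by omega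
      have hj' : d - 1 - (j : ℕ) < d := by omega
      simp only [hv, dif_pos hj', hj]
    rw [traj_linSys_eq_sum, h2, h1, add_neg_cancel]
  have hz : ∀ i, traj (linSys A B) c v (d + i) = 0 := by
    intro i
    have h0 : (fun k => v (d + k)) = 0 := by
      funext k
      simp [hv]
    rw [traj_add, hd, h0, traj_linSys_zero, Matrix.mulVec_zero]
  have hgrow : ∀ k, ‖traj (linSys A B) c v k‖ ≤ s ^ k * ‖c‖ := by
    intro k
    induction k with
    | zero => simp [traj]
    | succ k ih =>
      have hsk : 1 ≤ s ^ k := one_le_pow₀ hs1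
      calc ‖traj (linSys A B) c v (k + 1)‖
          ≤ ‖A.mulVec (traj (linSys A B) c v k)‖ + ‖B.mulVec (v k)‖ := norm_add_le _ _
        _ ≤ CA * (s ^ k * ‖c‖) + CB * (C₁ * ‖c‖) := by
            refine add_le_add ((hCA _).trans ?_) ((hCB _).trans ?_)
            · gcongr
            · gcongr
              exact hvC k
        _ ≤ CA * (s ^ k * ‖c‖) + s ^ k * (CB * (C₁ * ‖c‖)) + s ^ k * ‖c‖ := by
            have h1 : 1 * (CB * (C₁ * ‖c‖)) ≤ s ^ k * (CB * (C₁ * ‖c‖)) := by gcongr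
            have h2 : 0 ≤ s ^ k * ‖c‖ := by positivity
            linarith
        _ = s ^ (k + 1) * ‖c‖ := by rw [pow_succ, hs]; ring
  refine ⟨v, fun k => ⟨(hvC k).trans ?_, ?_, ?_⟩⟩
  · gcongr
    exact le_add_of_nonneg_right (by positivity)
  · rcases le_or_gt k d with hk | hk
    · refine (hgrow k).trans ?_
      gcongr
      exact (pow_le_pow_right₀ hs1 hk).trans (le_add_of_nonneg_left hC₁0)
    · obtain ⟨i, rfl⟩ := Nat.exists_eq_add_of_le hk.le
      rw [hz, norm_zero]
      positivity
  · intro hk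
    obtain ⟨i, rfl⟩ := Nat.exists_eq_add_of_le hk
    exact hz i

/-! ### Blocks near the origin and near periodic trajectories -/

/-- For all large `n`, about `|det A⁺| ^ n` controls suffice to return every point of a neighborhood
`G` of the origin to `G` at time `n` along bounded trajectories. A control steers to the origin a
center `c` in the unstable subspace; it moves a nearby point `y` to `A ^ n (y - c)`. -/
theorem exists_blocks_zero {A : Matrix (Fin d) (Fin d) ℝ} {B : Matrix (Fin d) (Fin m) ℝ}
    (hAB : IsControllablePair A B) (hyp : IsHyperbolic A) :
    ∃ (C κ : ℝ) (G : Set (Fin d → ℝ)), 0 ≤ C ∧ G ∈ 𝓝 0 ∧ ∀ᶠ n : ℕ in atTop,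
      ∃ S : Finset (ℕ → Fin m → ℝ), S.Nonempty ∧
        Real.log S.card ≤ κ + n * Real.log ‖unstableDet A‖ ∧ (∀ v ∈ S, ∀ k, ‖v k‖ ≤ C) ∧
        ∀ y ∈ G, ∃ v ∈ S, traj (linSys A B) y v n ∈ G ∧
          ∀ k ≤ n, ‖traj (linSys A B) y v k‖ ≤ C := by
  classical
  obtain ⟨a, b, M, N, e, he, hM, hN, hdet⟩ := exists_hyperbolic_splitting A hyp
  obtain ⟨hMdet, CM, hCM0, hCM⟩ := exists_norm_le_pow_mulVec M hM
  obtain ⟨⟨CN, hCN0, hCN⟩, hNev⟩ := exists_norm_pow_mulVec_le N hN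
  obtain ⟨C₀, hC₀0, hC₀⟩ := hAB.exists_null_control
  have hpow : ∀ (k : ℕ) x, e ((A ^ k).mulVec x) =
      ((M ^ k).mulVec (e x).1, (N ^ k).mulVec (e x).2) := by
    intro k
    induction k with
    | zero => simp
    | succ k ih =>
      intro x
      rw [pow_succ, ← Matrix.mulVec_mulVec, ih, he, pow_succ, pow_succ, ← Matrix.mulVec_mulVec,
        ← Matrix.mulVec_mulVec]
  set Ce := ‖LinearMap.toContinuousLinearMap (e.symm : (Fin a → ℝ) × (Fin b → ℝ) →ₗ[ℝ] Fin d → ℝ)‖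
  have hCe : ∀ p, ‖e.symm p‖ ≤ Ce * ‖p‖ := (LinearMap.toContinuousLinearMap
    (e.symm : (Fin a → ℝ) × (Fin b → ℝ) →ₗ[ℝ] Fin d → ℝ)).le_opNorm
  have hCe0 : 0 ≤ Ce := norm_nonneg _
  set C := C₀ * Ce + Ce * max CM CN with hC
  set G : Set (Fin d → ℝ) := e ⁻¹' Metric.closedBall 0 1 with hG
  have hGmem : ∀ y, y ∈ G ↔ ‖(e y).1‖ ≤ 1 ∧ ‖(e y).2‖ ≤ 1 := fun y => by
    rw [hG, mem_preimage, mem_closedBall_zero_iff, Prod.norm_def, max_le_iff]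
  have hCM' : 0 ≤ max CM CN := hCM0.trans (le_max_left _ _)
  refine ⟨C, a * Real.log (2 * (2 + CM)), G, by positivity, ?_, ?_⟩
  · have hcont : Continuous e := (e : (Fin d → ℝ) →ₗ[ℝ] (Fin a → ℝ) × (Fin b → ℝ)).continuous_of_finiteDimensional
    refine hcont.continuousAt.preimage_mem_nhds ?_
    rw [map_zero]
    exact Metric.closedBall_mem_nhds _ one_pos
  filter_upwards [hNev, eventually_ge_atTop d] with n hn hdn
  have hMn : (M ^ n).det ≠ 0 := by
    rw [Matrix.det_pow]
    exact pow_ne_zero _ hMdet.ne_zero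
  obtain ⟨S, hScard, hS1, hScov⟩ := exists_centers (M ^ n) hMn hCM0 (hCM n)
  choose v hv using hC₀
  set c : (Fin a → ℝ) → Fin d → ℝ := fun z => e.symm (z, 0) with hc
  have hcC : ∀ z ∈ S, ‖c z‖ ≤ Ce := by
    intro z hz
    refine (hCe _).trans (mul_le_of_le_one_right hCe0 ?_)
    simpa [Prod.norm_def] using hS1 z hz
  have hvC : ∀ z ∈ S, ∀ k, ‖v (c z) k‖ ≤ C₀ * Ce ∧
      ‖traj (linSys A B) (c z) (v (c z)) k‖ ≤ C₀ * Ce := by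
    intro z hz k
    have h1 : C₀ * ‖c z‖ ≤ C₀ * Ce := by
      gcongr
      exact hcC z hz
    exact ⟨(hv (c z) k).1.trans h1, (hv (c z) k).2.1.trans h1⟩
  have hSne : S.Nonempty := by
    obtain ⟨z, hz, -⟩ := hScov 0 (by simp)
    exact ⟨z, hz⟩
  refine ⟨S.image fun z => v (c z), hSne.image _, ?_, ?_, ?_⟩
  · have hcard : (0 : ℝ) < (S.image fun z => v (c z)).card := by
      exact_mod_cast Finset.card_pos.2 (hSne.image _)
    have hle : ((S.image fun z => v (c z)).card : ℝ) ≤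
        (2 * (2 + CM)) ^ a * ‖unstableDet A‖ ^ n := by
      rw [hdet, ← abs_pow, ← Matrix.det_pow]
      exact le_trans (by exact_mod_cast Finset.card_image_le) hScard
    refine (Real.log_le_log hcard hle).trans_eq ?_
    have hpos : ‖unstableDet A‖ ≠ 0 := by
      rw [hdet]
      exact abs_ne_zero.2 hMdet.ne_zero
    rw [Real.log_mul (by positivity) (pow_ne_zero _ hpos), Real.log_pow, Real.log_pow]
  · intro w hw k
    obtain ⟨z, hz, rfl⟩ := Finset.mem_image.1 hw
    refine (hvC z hz k).1.trans ?_
    exact le_add_of_nonneg_right (by positivity)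
  · intro y hy
    rw [hGmem] at hy
    obtain ⟨z, hz, hzy⟩ := hScov (e y).1 hy.1
    have hsplit : ∀ k, traj (linSys A B) y (v (c z)) k =
        traj (linSys A B) (c z) (v (c z)) k + (A ^ k).mulVec (y - c z) := by
      intro k
      rw [← traj_linSys_zero A B, ← traj_linSys_add, add_sub_cancel, add_zero]
    have heA : ∀ k, e ((A ^ k).mulVec (y - c z)) =
        ((M ^ k).mulVec ((e y).1 - z), (N ^ k).mulVec (e y).2) := by
      intro k
      rw [hpow, map_sub, hc, e.apply_symm_apply, Prod.fst_sub, Prod.snd_sub, sub_zero]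
    refine ⟨v (c z), Finset.mem_image.2 ⟨z, hz, rfl⟩, ?_, fun k hk => ?_⟩
    · rw [hsplit, (hv (c z) n).2.2 hdn, zero_add, hGmem, heA]
      exact ⟨hzy, (hn _).trans hy.2⟩
    · rw [hsplit]
      refine (norm_add_le _ _).trans (add_le_add (hvC z hz k).2 ?_)
      rw [← e.symm_apply_apply ((A ^ k).mulVec (y - c z)), heA]
      refine (hCe _).trans ?_
      gcongr
      refine max_le_max ?_ ?_
      · -- the expansion of `M` bounds the state at time `k` by the state at time `n`
        refine (hCM (n - k) _).trans ?_
        rw [Matrix.mulVec_mulVec, ← pow_add, Nat.sub_add_cancel hk]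
        exact mul_le_of_le_one_right hCM0 hzy
      · exact (hCN k _).trans (mul_le_of_le_one_right hCN0 hy.2)

/-- Blocks near a periodic trajectory: those near the origin, scaled down and added to the periodic
control. Their length is a multiple of the period, and by continuity the potential along them
exceeds the one along the periodic trajectory by at most `ε`. -/
theorem exists_blocks_periodic {A : Matrix (Fin d) (Fin d) ℝ} {B : Matrix (Fin d) (Fin m) ℝ}
    (hAB : IsControllablePair A B) (hyp : IsHyperbolic A) {U : Set (Fin m → ℝ)}
    {D : Set (Fin d → ℝ)} {f : (Fin d → ℝ) × (Fin m → ℝ) → ℝ}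
    (hf : ContinuousOn f (closure D ×ˢ U)) {τ : ℕ} {x₀ : Fin d → ℝ} {u₀ : ℕ → Fin m → ℝ}
    (h : IsPeriodicPair (linSys A B) U D τ x₀ u₀) {ε : ℝ} (hε : 0 < ε) :
    ∃ N : ℕ, 0 < N ∧ ∃ W ∈ 𝓝 x₀, W ⊆ D ∧ ∃ S : Finset (ℕ → Fin m → ℝ), S.Nonempty ∧
      (∀ u ∈ S, u ∈ controls U) ∧
      Real.log S.card / (N * τ : ℕ) ≤ Real.log ‖unstableDet A‖ + ε ∧
      ∀ x ∈ W, ∃ u ∈ S, traj (linSys A B) x u (N * τ) ∈ W ∧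
        ∀ k < N * τ, traj (linSys A B) x u k ∈ D ∧
          f (traj (linSys A B) x u k, u k) ≤ f (traj (linSys A B) x₀ u₀ k, u₀ k) + ε := by
  classical
  obtain ⟨hτ, hu, hper, hxper, hxD, huU⟩ := h
  obtain ⟨C, κ, G, hC0, hG, hev⟩ := exists_blocks_zero hAB hyp
  have huU' : ∀ k, u₀ k ∈ interior U := fun k => by
    rw [← hper.map_mod_nat k]
    exact huU _ (Nat.mod_lt _ hτ)
  -- a distance `δ` that works at all times of one period, hence at all times
  have hloc : ∀ k, ∀ᶠ δ : ℝ in 𝓝[>] 0, ∀ x u, ‖x - traj (linSys A B) x₀ u₀ k‖ < δ →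
      ‖u - u₀ k‖ < δ → x ∈ D ∧ u ∈ U ∧ f (x, u) ≤ f (traj (linSys A B) x₀ u₀ k, u₀ k) + ε := by
    intro k
    have hnhds : ∀ᶠ p in 𝓝 (traj (linSys A B) x₀ u₀ k, u₀ k), p.1 ∈ D ∧ p.2 ∈ U ∧
        f p ≤ f (traj (linSys A B) x₀ u₀ k, u₀ k) + ε := by
      have h1 : D ×ˢ U ∈ 𝓝 (traj (linSys A B) x₀ u₀ k, u₀ k) :=
        prod_mem_nhds (mem_interior_iff_mem_nhds.1 (hxD k)) (mem_interior_iff_mem_nhds.1 (huU' k))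
      have h2 := hf.continuousAt (mem_of_superset h1 (prod_mono_left subset_closure))
      filter_upwards [h1, h2.eventually_lt_const (lt_add_of_pos_right _ hε)] with p hp hp'
      exact ⟨hp.1, hp.2, hp'.le⟩
    obtain ⟨δ, hδ, hball⟩ := Metric.eventually_nhds_iff.1 hnhds
    filter_upwards [Ioo_mem_nhdsGT hδ] with δ' hδ' x u hx hu'
    refine hball (y := (x, u)) ?_
    rw [Prod.dist_eq, max_lt_iff, dist_eq_norm, dist_eq_norm]
    exact ⟨hx.trans hδ'.2, hu'.trans hδ'.2⟩
  obtain ⟨δ, hδloc, hδ0⟩ := (((eventually_all_finset (Finset.range τ)).2 fun k _ =>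
    hloc k).and self_mem_nhdsWithin).exists
  have hδ : ∀ k x u, ‖x - traj (linSys A B) x₀ u₀ k‖ < δ →
      ‖u - u₀ k‖ < δ → x ∈ D ∧ u ∈ U ∧ f (x, u) ≤ f (traj (linSys A B) x₀ u₀ k, u₀ k) + ε := by
    intro k
    rw [← hper.map_mod_nat k, ← hxper.map_mod_nat k]
    exact hδloc _ (Finset.mem_range.2 (Nat.mod_lt _ hτ))
  set b := δ / (C + 1) with hb
  have hb0 : 0 < b := div_pos hδ0 (by linarith)
  have hbC : ∀ {n : ℕ} (z : Fin n → ℝ), ‖z‖ ≤ C → ‖b • z‖ < δ := by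
    intro n z hz
    rw [norm_smul, Real.norm_of_nonneg hb0.le]
    calc b * ‖z‖ < b * (C + 1) := by
          gcongr
          linarith
      _ = δ := div_mul_cancel₀ _ (by linarith)
  -- a number of periods for which the blocks exist and `κ` has become negligible
  have hmul : Tendsto (fun N : ℕ => N * τ) atTop atTop := tendsto_id.atTop_mul_const' hτ
  have hκ : Tendsto (fun n : ℕ => κ / (n : ℝ)) atTop (𝓝 0) := tendsto_const_div_atTop_nhds_zero_nat κ
  obtain ⟨N, ⟨⟨S, hSne, hScard, hSC, hSG⟩, hNκ⟩, hN0⟩ :=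
    ((hmul.eventually (hev.and (hκ.eventually_le_const hε))).and (eventually_gt_atTop 0)).exists
  have hn0 : (0 : ℝ) < (N * τ : ℕ) := by
    exact_mod_cast Nat.mul_pos hN0 hτ
  have htraj : ∀ y v k, traj (linSys A B) (x₀ + b • y) (u₀ + b • v) k =
      traj (linSys A B) x₀ u₀ k + b • traj (linSys A B) y v k := fun y v k => by
    rw [traj_linSys_add, traj_linSys_smul]
  have hstep : ∀ y v k, ‖traj (linSys A B) y v k‖ ≤ C → ‖v k‖ ≤ C →
      traj (linSys A B) (x₀ + b • y) (u₀ + b • v) k ∈ D ∧ (u₀ + b • v) k ∈ U ∧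
      f (traj (linSys A B) (x₀ + b • y) (u₀ + b • v) k, (u₀ + b • v) k) ≤
        f (traj (linSys A B) x₀ u₀ k, u₀ k) + ε := by
    intro y v k hy hv
    refine hδ k _ _ ?_ ?_
    · rw [htraj, add_sub_cancel_left]
      exact hbC _ hy
    · rw [Pi.add_apply, add_sub_cancel_left]
      exact hbC _ hv
  refine ⟨N, hN0, {x | ∃ y ∈ G, x = x₀ + b • y}, ?_, ?_, S.image fun v => u₀ + b • v,
    hSne.image _, ?_, ?_, ?_⟩
  · have hcont : ContinuousAt (fun x : Fin d → ℝ => b⁻¹ • (x - x₀)) x₀ := by fun_prop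
    have hpre := hcont.preimage_mem_nhds (t := G) (by simpa using hG)
    refine mem_of_superset hpre fun x hx => ⟨_, hx, ?_⟩
    rw [smul_inv_smul₀ hb0.ne', add_sub_cancel]
  · rintro x ⟨y, hy, rfl⟩
    obtain ⟨v, hv, -, hk⟩ := hSG y hy
    exact (hstep y v 0 (hk 0 (Nat.zero_le _)) (hSC v hv 0)).1
  · intro u hu'
    obtain ⟨v, hv, rfl⟩ := Finset.mem_image.1 hu'
    intro k
    -- `hδ` bounds state and control together; the state is taken on the periodic trajectory
    refine (hδ k (traj (linSys A B) x₀ u₀ k) _ ?_ ?_).2.1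
    · rw [sub_self, norm_zero]
      exact hδ0
    · rw [Pi.add_apply, add_sub_cancel_left]
      exact hbC _ (hSC v hv k)
  · have hlog : Real.log (S.image fun v => u₀ + b • v).card ≤ Real.log S.card :=
      Real.log_le_log (by exact_mod_cast Finset.card_pos.2 (hSne.image _))
        (by exact_mod_cast Finset.card_image_le)
    rw [div_le_iff₀ hn0]
    rw [div_le_iff₀ hn0] at hNκ
    linarith
  · rintro x ⟨y, hy, rfl⟩
    obtain ⟨v, hv, hvG, hk⟩ := hSG y hy
    refine ⟨u₀ + b • v, Finset.mem_image.2 ⟨v, hv, rfl⟩, ⟨_, hvG, ?_⟩, fun k hkn => ?_⟩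
    · rw [htraj]
      congr 1
      simpa [traj] using (hxper.nat_mul N) 0
    · have := hstep y v k (hk k hkn.le) (hSC v hv k)
      exact ⟨this.1, this.2.2⟩

/-! ### Reaching the blocks from a compact set -/

/-- By compactness finitely many controls bring a compact subset of a control set into a given
neighborhood of a point of the control set; by the no-return property they do so within the control
set, where the potential is bounded along them. -/
theorem exists_steering {X V : Type*} [TopologicalSpace X] [TopologicalSpace V]
    {F : X → V → X} (hF : ∀ v, Continuous fun x => F x v) {U : Set V} {D K W : Set X}
    (hD : IsControlSet F U D) (hK : IsCompact K) (hKD : K ⊆ D) {x₀ : X} (hx₀ : x₀ ∈ D)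
    (hW : W ∈ 𝓝 x₀) (hWD : W ⊆ D) {f : X × V → ℝ} (hf : ContinuousOn f (closure D ×ˢ U)) :
    ∃ (P : Finset (ℕ × (ℕ → V))) (c : ℝ), (∀ p ∈ P, p.2 ∈ controls U) ∧
      ∀ x ∈ K, ∃ p ∈ P, traj F x p.2 p.1 ∈ W ∧
        ∀ k < p.1, traj F x p.2 k ∈ D ∧ f (traj F x p.2 k, p.2 k) ≤ c := by
  classical
  obtain ⟨u₁, -⟩ := hD.1.2.2 x₀ hx₀
  have : Nonempty (ℕ → V) := ⟨u₁⟩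
  have hreach : ∀ x ∈ K, ∃ p : ℕ × (ℕ → V), p.2 ∈ controls U ∧
      traj F x p.2 p.1 ∈ interior W := by
    intro x hx
    obtain ⟨y, hyW, k, -, u, hu, rfl⟩ := mem_closure_iff.1 (hD.1.2.1 x (hKD hx) hx₀) (interior W)
      isOpen_interior (mem_interior_iff_mem_nhds.2 hW)
    exact ⟨(k, u), hu, hyW⟩
  choose! p hpU hpW using hreach
  obtain ⟨t, htK, hcov⟩ := hK.elim_nhds_subcover
    (fun x => {z | traj F z (p x).2 (p x).1 ∈ interior W}) fun x hx =>
      (isOpen_interior.preimage (continuous_traj hF _ _)).mem_nhds (hpW x hx)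
  have hbdd : ∀ (q : ℕ × (ℕ → V)) (k : ℕ), ∃ c : ℝ, q.2 ∈ controls U →
      ∀ x ∈ K, traj F x q.2 k ∈ D → f (traj F x q.2 k, q.2 k) ≤ c := by
    intro q k
    by_cases hq : q.2 ∈ controls U
    · have hcomp : IsCompact (((fun x => traj F x q.2 k) '' K ∩ closure D) ×ˢ {q.2 k}) :=
        ((hK.image (continuous_traj hF _ _)).inter_right isClosed_closure).prod isCompact_singleton
      obtain ⟨c, hc⟩ := hcomp.bddAbove_image (f := f) (hf.mono (prod_mono inter_subset_right
        (singleton_subset_iff.2 (hq k))))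
      exact ⟨c, fun _ x hx hxD => hc
        ⟨(traj F x q.2 k, q.2 k), ⟨⟨⟨x, hx, rfl⟩, subset_closure hxD⟩, mem_singleton _⟩, rfl⟩⟩
    · exact ⟨0, fun h => absurd h hq⟩
  choose c hc using hbdd
  refine ⟨t.image p, ∑ q ∈ t.image p, ∑ k ∈ Finset.range q.1, |c q k|, ?_, ?_⟩
  · intro q hq
    obtain ⟨x, hx, rfl⟩ := Finset.mem_image.1 hq
    exact hpU x (htK x hx)
  · intro x hx
    obtain ⟨z, hz, hxz⟩ := mem_iUnion₂.1 (hcov hx)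
    have hq : p z ∈ t.image p := Finset.mem_image_of_mem p hz
    have hzU := hpU z (htK z hz)
    have hxW : traj F x (p z).2 (p z).1 ∈ W := interior_subset hxz
    refine ⟨p z, hq, hxW, fun k hk => ?_⟩
    have hkD := hD.traj_mem hF (hKD hx) hzU (hWD hxW) hk.le
    refine ⟨hkD, (hc (p z) k hzU x hx hkD).trans ((le_abs_self _).trans ?_)⟩
    refine (Finset.single_le_sum (f := fun k => |c (p z) k|) (fun _ _ => abs_nonneg _)
      (Finset.mem_range.2 hk)).trans ?_
    exact Finset.single_le_sum (f := fun q : ℕ × (ℕ → V) => ∑ k ∈ Finset.range q.1, |c q k|)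
      (fun _ _ => Finset.sum_nonneg fun _ _ => abs_nonneg _) hq

/-- Every compact subset of the control set obeys the bound given by a periodic pair. -/
theorem totalPressure_le_of_isPeriodicPair {A : Matrix (Fin d) (Fin d) ℝ}
    {B : Matrix (Fin d) (Fin m) ℝ} (hAB : IsControllablePair A B) (hyp : IsHyperbolic A)
    {U : Set (Fin m → ℝ)} {D K : Set (Fin d → ℝ)} (hD : IsControlSet (linSys A B) U D)
    (hK : IsCompact K) (hK0 : K.Nonempty) (hKD : K ⊆ D)
    {f : (Fin d → ℝ) × (Fin m → ℝ) → ℝ} (hf : ContinuousOn f (closure D ×ˢ U))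
    {τ : ℕ} {x₀ : Fin d → ℝ} {u₀ : ℕ → Fin m → ℝ}
    (h : IsPeriodicPair (linSys A B) U D τ x₀ u₀) :
    totalPressure (linSys A B) U f K D ≤ ((Real.log ‖unstableDet A‖ +
      (τ : ℝ)⁻¹ * potentialSum (linSys A B) f τ x₀ u₀ : ℝ) : EReal) := by
  set a := (τ : ℝ)⁻¹ * potentialSum (linSys A B) f τ x₀ u₀ with ha
  have hτ : 0 < τ := h.1
  have key : ∀ ε : ℝ, 0 < ε → totalPressure (linSys A B) U f K D ≤
      ((Real.log ‖unstableDet A‖ + a + 2 * ε : ℝ) : EReal) := by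
    intro ε hε
    obtain ⟨N, hN, W, hW, hWD, S, hS0, hSU, hScard, hSW⟩ := exists_blocks_periodic hAB hyp hf h hε
    obtain ⟨P, c, hP, hPK⟩ := exists_steering (continuous_linSys A B) hD hK hKD
      (interior_subset (h.2.2.2.2.1 0)) hW hWD hf
    set g : ℕ → ℝ := fun k => f (traj (linSys A B) x₀ u₀ k, u₀ k) with hg
    have hgper : Function.Periodic g τ := fun k => by
      simp only [hg, h.2.2.2.1 k, h.2.2.1 k]
    have hgper' : Function.Periodic (fun k => g k + ε) (N * τ) := fun k => by
      have := hgper.nat_mul N k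
      simp only [Nat.cast_id] at this
      simp only [this]
    refine (totalPressure_le_of_blocks (Nat.mul_pos hN hτ) hK0 hgper' S hSU hS0 hSW P hP c
      hPK).trans (EReal.coe_le_coe_iff.2 ?_)
    have hsum : ∀ M : ℕ, ∑ k ∈ Finset.range (M * τ), (g k + ε) = (M * τ : ℕ) * (a + ε) := by
      intro M
      induction M with
      | zero => simp
      | succ M ih =>
        have h1 : ∑ k ∈ Finset.range τ, (g (M * τ + k) + ε) = τ * (a + ε) := by
          have h2 : ∀ k, g (M * τ + k) = g k := fun k => by
            have := hgper.nat_mul M k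
            rwa [Nat.cast_id, add_comm] at this
          simp only [h2, Finset.sum_add_distrib, Finset.sum_const, Finset.card_range,
            nsmul_eq_mul, ha, potentialSum]
          field_simp
          rfl
        rw [add_mul, one_mul, Finset.sum_range_add, ih, h1]
        push_cast
        ring
    rw [hsum N, mul_div_cancel_left₀ _ (by positivity)]
    linarith
  have hlim : Tendsto (fun ε : ℝ => ((Real.log ‖unstableDet A‖ + a + 2 * ε : ℝ) : EReal)) (𝓝[>] 0)
      (𝓝 ((Real.log ‖unstableDet A‖ + a : ℝ) : EReal)) := by
    have hcont : Continuous fun ε : ℝ => ((Real.log ‖unstableDet A‖ + a + 2 * ε : ℝ) : EReal) :=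
      continuous_coe_real_ereal.comp (by fun_prop)
    simpa using (hcont.tendsto 0).mono_left nhdsWithin_le_nhds
  exact ge_of_tendsto hlim (eventually_mem_nhdsWithin.mono fun ε hε => key ε hε)

end Linear

end DTControl

theorem proposition6p1 (d m : ℕ)
    (A : Matrix (Fin d) (Fin d) ℝ) (B : Matrix (Fin d) (Fin m) ℝ) (U : Set (Fin m → ℝ))
    (hA : IsUnit A)
    (hU_compact : IsCompact U) (hU_convex : Convex ℝ U) (hU_nhds : U ∈ 𝓝 (0 : Fin m → ℝ))
    (hU_closure : U = closure (interior U))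
    (hAB : IsControllablePair A B) (hyp : IsHyperbolic A)
    (D : Set (Fin d → ℝ)) (hD : IsControlSet (linSys A B) U D) (hD_int : (interior D).Nonempty)
    (f : (Fin d → ℝ) × (Fin m → ℝ) → ℝ) (hf : ContinuousOn f (closure D ×ˢ U)) :
    ∃ K : Set (Fin d → ℝ), IsCompact K ∧ K ⊆ D ∧ (interior K).Nonempty ∧
      IsAdmissiblePair (linSys A B) U K D ∧
      totalPressure (linSys A B) U f K D ≤
        ((Real.log ‖unstableDet A‖ : ℝ) : EReal) +
          infPeriodicAverage (linSys A B) U D f d := by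
  obtain ⟨x, hx⟩ := hD_int
  obtain ⟨r, hr, hball⟩ := Metric.nhds_basis_closedBall.mem_iff.1 (mem_interior_iff_mem_nhds.1 hx)
  have hcomp := isCompact_closedBall x r
  have hne : (Metric.closedBall x r).Nonempty := ⟨x, Metric.mem_closedBall_self hr.le⟩
  refine ⟨Metric.closedBall x r, hcomp, hball,
    ⟨x, Metric.ball_subset_interior_closedBall (Metric.mem_ball_self hr)⟩,
    ⟨hne, hball, hcomp, fun y hy => hD.1.2.2 y (hball hy)⟩, ?_⟩
  rw [add_comm, ← EReal.sub_le_iff_le_add (Or.inl (EReal.coe_ne_bot _))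
    (Or.inl (EReal.coe_ne_top _))]
  refine le_sInf ?_
  rintro _ ⟨τ, y, u, -, h, rfl⟩
  rw [EReal.sub_le_iff_le_add (Or.inl (EReal.coe_ne_bot _)) (Or.inl (EReal.coe_ne_top _)),
    add_comm, ← EReal.coe_add]
  exact totalPressure_le_of_isPeriodicPair hAB hyp hD hcomp hne hball hf h
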